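/- Let $\mathbb K\in\{\mathbb R,\mathbb C\}$ and let $(\Omega,\Sigma,\mu)$ be a finite atomless measure space; $L_0(\mu)$ denotes the space of classes of a.e. equal measurable functions $\Omega\to\mathbb K$. An $F$-space is a complete metric linear space over $\mathbb K$ whose metric $\rho$ is invariant, with $F$-norm $\|x\|=\rho(x,0)$. A Köthe $F$-space on $(\Omega,\Sigma,\mu)$ is an $F$-space $X$ that is a linear subspace of $L_0(\mu)$, contains $\mathbf 1_\Omega$, and is such that $x\in L_0(\mu)$, $y\in X$ and $|x|\le|y|$ imply $x\in X$ and $\|x\|\le\|y\|$. A sign is a $\{-1,0,1\}$-valued element of $L_0(\mu)$; it is a sign on $A\in\Sigma$ if its support is $A$ up to a null set, and it is of mean zero if its integral is $0$. A continuous linear operator $T:X\to Y$ from a Köthe $F$-space to an $F$-space is narrow if for all $A\in\Sigma$ with $\mu(A)>0$ and all $\varepsilon>0$ there is a mean zero sign $x$ on $A$ with $\|Tx\|<\varepsilon$. For a family $(y_i)_{i\in I}$ in an $F$-space $Y$ indexed by a well-ordered set $I$, partial sums are defined by transfinite recursion: the empty sum is $0$, at successor steps the next term is added, and at limit steps the limit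 of the preceding partial sums is taken (if it exists). A family $(e_i)_{i\in I}$ in $Y$, with $I$ well-ordered, is a transfinite basis of $Y$ if for every $y\in Y$ there is a unique family $(a_i)_{i\in I}$ of scalars such that $J=\{i\in I:a_i\neq0\}$ is at most countable and $y=\sum_{i\in J}a_ie_i=\sum_{i\in I}a_ie_i$. **Theorem 3.** Let $X$ be a Köthe $F$-space on $(\Omega,\Sigma,\mu)$, let $Z$ be the set of all signs in $X$, and let $Y$ be an $F$-space with a transfinite basis. Let $T_1,T_2:X\to Y$ be narrow continuous linear operators such that $T_2(Z)$ is relatively compact in $Y$. Then $T_1+T_2$ is narrow. -/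

import Mathlib

/-! F-spaces. For an additive group, `NormedAddCommGroup` is exactly a norm `‖x‖ = ρ(x, 0)` coming
from an invariant metric `ρ` (no homogeneity is required), so an F-space over `𝕂` is a type with
`[NormedAddCommGroup Y] [Module 𝕂 Y] [ContinuousSMul 𝕂 Y] [CompleteSpace Y]`. -/

open MeasureTheory Filter Topology

/-- The measure `μ` is atomless: each measurable set of positive measure has a measurable subset
of strictly smaller positive measure. -/
def Atomless {Ω : Type*} [MeasurableSpace Ω] (μ : Measure Ω) : Prop :=
  ∀ A : Set Ω, MeasurableSet A → 0 < μ A →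
    ∃ B : Set Ω, B ⊆ A ∧ MeasurableSet B ∧ 0 < μ B ∧ μ B < μ A

/-- `X`, regarded as a linear subspace of `L₀(μ)` through the inclusion `ι`, satisfies the
conditions which make an F-space a Köthe F-space on `(Ω, Σ, μ)`: it contains `𝟏_Ω`, and it is
solid with a monotone F-norm. -/
structure IsKothe {Ω : Type*} [MeasurableSpace Ω] {μ : Measure Ω} {𝕂 : Type*} [RCLike 𝕂]
    {X : Type*} [NormedAddCommGroup X] [Module 𝕂 X] (ι : X →ₗ[𝕂] (Ω →ₘ[μ] 𝕂)) : Prop where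
  injective : Function.Injective ι
  one_mem : ∃ u : X, ι u = 1
  solid : ∀ (f : Ω →ₘ[μ] 𝕂) (y : X), (∀ᵐ ω ∂μ, ‖f ω‖ ≤ ‖ι y ω‖) → ∃ x : X, ι x = f ∧ ‖x‖ ≤ ‖y‖

/-- A sign: a `{-1, 0, 1}`-valued element of `L₀(μ)`. -/
def IsSign {Ω : Type*} [MeasurableSpace Ω] {μ : Measure Ω} {𝕂 : Type*} [RCLike 𝕂]
    (f : Ω →ₘ[μ] 𝕂) : Prop :=
  ∀ᵐ ω ∂μ, f ω = -1 ∨ f ω = 0 ∨ f ω = 1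

/-- A sign on the set `A`: a sign whose support is `A` (up to a null set). -/
def IsSignOn {Ω : Type*} [MeasurableSpace Ω] {μ : Measure Ω} {𝕂 : Type*} [RCLike 𝕂]
    (f : Ω →ₘ[μ] 𝕂) (A : Set Ω) : Prop :=
  IsSign f ∧ ∀ᵐ ω ∂μ, f ω ≠ 0 ↔ ω ∈ A

/-- `T : X → Y` is narrow, where `ι` is the inclusion of `X` into `L₀(μ)`. -/
def IsNarrow {Ω : Type*} [MeasurableSpace Ω] {μ : Measure Ω} {𝕂 : Type*} [RCLike 𝕂]
    {X : Type*} [NormedAddCommGroup X] [Module 𝕂 X] (ι : X →ₗ[𝕂] (Ω →ₘ[μ] 𝕂))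
    {Y : Type*} [NormedAddCommGroup Y] [Module 𝕂 Y] (T : X →L[𝕂] Y) : Prop :=
  ∀ A : Set Ω, MeasurableSet A → 0 < μ A → ∀ ε : ℝ, 0 < ε →
    ∃ x : X, IsSignOn (ι x) A ∧ ∫ ω, ι x ω ∂μ = 0 ∧ ‖T x‖ < ε

/-- `S` is the family of partial sums of the family `v` indexed by the well-ordered set `I`:
`S i` is the sum of all `v j` with `j < i`, and `S ⊤` is the sum of the whole family. -/
structure IsTransfinitePartialSums {I : Type*} [LinearOrder I] [WellFoundedLT I]
    {Y : Type*} [NormedAddCommGroup Y] (v : I → Y) (S : WithTop I → Y) : Prop where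
  zero : ∀ i : WithTop I, IsMin i → S i = 0
  succ : ∀ (i : I) (j : WithTop I), (i : WithTop I) ⋖ j → S j = S i + v i
  limit : ∀ j : WithTop I, Order.IsSuccLimit j →
    Tendsto (fun i : Set.Iio j => S i) atTop (𝓝 (S j))

/-- The transfinite sum of the family `v` indexed by the well-ordered set `I` exists and is `y`. -/
def HasTransfiniteSum {I : Type*} [LinearOrder I] [WellFoundedLT I]
    {Y : Type*} [NormedAddCommGroup Y] (v : I → Y) (y : Y) : Prop :=
  ∃ S : WithTop I → Y, IsTransfinitePartialSums v S ∧ S ⊤ = y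

/-- The family `e` indexed by the well-ordered set `I` is a transfinite basis of `Y`. -/
def IsTransfiniteBasis (𝕂 : Type*) [RCLike 𝕂] {I : Type*} [LinearOrder I] [WellFoundedLT I]
    {Y : Type*} [NormedAddCommGroup Y] [Module 𝕂 Y] (e : I → Y) : Prop :=
  ∀ y : Y, ∃! a : I → 𝕂, {i | a i ≠ 0}.Countable ∧
    HasTransfiniteSum (fun j : {i | a i ≠ 0} => a j • e j) y ∧
    HasTransfiniteSum (fun i => a i • e i) y

/-! Since `T₂` maps signs into a compact set, smallness of `T₂ x` for signs `x` is detected by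
finitely many continuous additive functionals `φ k`, as soon as such functionals separate the points
of `Y`. Coefficient functionals of a transfinite basis do so once they are known to be continuous.
That is a Baire category argument: the vectors all of whose partial sums have norm at most `ε` form
a neighbourhood of zero.

It remains to find a mean zero sign `x` on `A` for which `T₁ x` and all `g k x = φ k (T₂ x)` are
small. Each `g k` is bounded on signs, so it has a finite, superadditive variation on sets.
Narrowness of `T₂` excludes atoms of this variation, so `A` splits into finitely many pieces of
variation below `δ`; this is phrased as an induction principle for sets. On each piece narrowness of
`T₁` gives a mean zero sign with tiny image. When signs are added, `±` is chosen to make the cross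
term `∑ g k x * g k y` nonpositive, so the sums of squares at most add up, to at most `δ` times the
total variation. -/

/-- A Zabreiko-type lemma: a family of sets that behaves like the balls of a countably subadditive
absorbing functional on an F-space consists of neighbourhoods of zero. -/
theorem exists_ball_subset_of_countably_subadditive (𝕂 : Type*) [RCLike 𝕂]
    {Y : Type*} [NormedAddCommGroup Y] [Module 𝕂 Y] [ContinuousSMul 𝕂 Y] [CompleteSpace Y]
    (B : ℝ → Set Y)
    (hsub : ∀ a, ∀ x ∈ B a, ∀ y ∈ B a, x - y ∈ B (2 * a))
    (habs : ∀ ε, 0 < ε → ∀ y, ∃ n : ℕ, ((n : 𝕂) + 1)⁻¹ • y ∈ B ε)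
    (hsum : ∀ ε, 0 < ε → ∀ (u : ℕ → Y) (y : Y), (∀ n, u n ∈ B (ε / 2 ^ (n + 1))) →
      Tendsto (fun n => ∑ k ∈ Finset.range n, u k) atTop (𝓝 y) → y ∈ B ε)
    (ε : ℝ) (hε : 0 < ε) : ∃ δ > 0, ∀ y : Y, ‖y‖ < δ → y ∈ B ε := by
  -- By Baire, the closure of some `(n + 1) • B (ε / 2)` contains a ball. Differences of its points
  -- fill a ball around zero, so `B ε` is dense near zero.
  have approx : ∀ ε : ℝ, 0 < ε → ∃ δ > 0, ∀ y : Y, ‖y‖ < δ → ∀ η > 0,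
      ∃ x ∈ B ε, ‖y - x‖ < η := by
    intro ε hε
    obtain ⟨n, z, hz⟩ := nonempty_interior_of_iUnion_of_closed
      (f := fun n : ℕ => closure {y : Y | ((n : 𝕂) + 1)⁻¹ • y ∈ B (ε / 2)})
      (fun n => isClosed_closure) (by
        refine Set.eq_univ_of_forall fun y => ?_
        obtain ⟨n, hn⟩ := habs (ε / 2) (half_pos hε) y
        exact Set.mem_iUnion.2 ⟨n, subset_closure hn⟩)
    obtain ⟨r, hr, hball⟩ := Metric.mem_nhds_iff.1 (mem_interior_iff_mem_nhds.1 hz)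
    have hn1 : (n : 𝕂) + 1 ≠ 0 := by exact_mod_cast Nat.succ_ne_zero n
    refine ⟨r / (n + 1), by positivity, fun y hy η hη => ?_⟩
    have hcont : Continuous fun x : Y => ((n : 𝕂) + 1)⁻¹ • x := continuous_const_smul _
    obtain ⟨η', hη', hs⟩ := Metric.continuousAt_iff.1 (hcont.continuousAt (x := 0)) η hη
    have h1 : z + (n + 1) • y ∈ Metric.ball z r := by
      rw [mem_ball_iff_norm, add_sub_cancel_left]
      have := norm_nsmul_le (n := n + 1) (a := y)
      rw [lt_div_iff₀ (by positivity)] at hy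
      push_cast at this
      linarith
    obtain ⟨z₁, hz₁, hd₁⟩ := Metric.mem_closure_iff.1 (hball h1) (η' / 2) (half_pos hη')
    obtain ⟨z₂, hz₂, hd₂⟩ := Metric.mem_closure_iff.1 (hball (Metric.mem_ball_self hr)) (η' / 2)
      (half_pos hη')
    refine ⟨((n : 𝕂) + 1)⁻¹ • z₁ - ((n : 𝕂) + 1)⁻¹ • z₂, ?_, ?_⟩
    · have := hsub _ _ hz₁ _ hz₂
      rwa [mul_div_cancel₀ ε two_ne_zero] at this
    · have hy' : y = ((n : 𝕂) + 1)⁻¹ • ((n + 1) • y) := by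
        have : ((n + 1) • y : Y) = ((n : 𝕂) + 1) • y := by
          rw [← Nat.cast_smul_eq_nsmul 𝕂]; push_cast; rfl
        rw [this, smul_smul, inv_mul_cancel₀ hn1, one_smul]
      have key : y - (((n : 𝕂) + 1)⁻¹ • z₁ - ((n : 𝕂) + 1)⁻¹ • z₂)
          = ((n : 𝕂) + 1)⁻¹ • ((z + (n + 1) • y - z₁) - (z - z₂)) := by
        conv_lhs => rw [hy']
        rw [← smul_sub, ← smul_sub]
        congr 1
        abel
      rw [key]
      have := hs (x := (z + (n + 1) • y - z₁) - (z - z₂)) (by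
        rw [dist_zero_right]
        rw [dist_eq_norm] at hd₁ hd₂
        linarith [norm_sub_le (z + (n + 1) • y - z₁) (z - z₂)])
      simpa using this
  choose! δ hδ happ using fun n : ℕ => approx (ε / 2 ^ (n + 1)) (by positivity)
  -- The second bound forces the remainders `r n` below to tend to zero.
  set d : ℕ → ℝ := fun n => min (δ n) ((1 / 2) ^ n) with hd
  have hdpos : ∀ n, 0 < d n := fun n => lt_min (hδ n) (by positivity)
  choose! f hfB hf using happ
  refine ⟨d 0, hdpos 0, fun y hy => ?_⟩
  -- Successive approximation: `r n` is what is left of `y` after subtracting the first `n`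
  -- approximants, the `n`-th taken from `B (ε / 2 ^ (n + 1))`.
  let r : ℕ → Y := fun n => Nat.rec y (fun k x => x - f k x (d (k + 1))) n
  have hr : ∀ n, r (n + 1) = r n - f n (r n) (d (n + 1)) := fun n => rfl
  have hrn : ∀ n, ‖r n‖ < d n := by
    intro n
    induction n with
    | zero => exact hy
    | succ k ih =>
      rw [hr]
      exact hf k _ (ih.trans_le (min_le_left _ _)) _ (hdpos _)
  refine hsum ε hε (fun n => f n (r n) (d (n + 1))) y
    (fun n => hfB n _ ((hrn n).trans_le (min_le_left _ _)) _ (hdpos _)) ?_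
  have hpart : ∀ n, ∑ k ∈ Finset.range n, f k (r k) (d (k + 1)) = y - r n := by
    intro n
    induction n with
    | zero => simp [r]
    | succ k ih => rw [Finset.sum_range_succ, ih, hr]; abel
  simp_rw [hpart]
  have h0 : Tendsto r atTop (𝓝 0) := by
    refine squeeze_zero_norm (a := fun n => (1 / 2 : ℝ) ^ n)
      (fun n => (hrn n).le.trans (min_le_right _ _)) ?_
    exact tendsto_pow_atTop_nhds_zero_of_lt_one (by norm_num) (by norm_num)
  simpa using tendsto_const_nhds.sub h0

/-! ### Transfinite partial sums -/

section PartialSums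

variable {I : Type*} [LinearOrder I] {Y : Type*} [NormedAddCommGroup Y]

theorem isMin_or_covBy_or_isSuccLimit (j : WithTop I) :
    IsMin j ∨ (∃ i : I, (i : WithTop I) ⋖ j) ∨ Order.IsSuccLimit j := by
  by_cases h : IsMin j
  · exact Or.inl h
  by_cases h' : Order.IsSuccPrelimit j
  · exact Or.inr (Or.inr ⟨h, h'⟩)
  · simp only [Order.IsSuccPrelimit, not_forall, not_not] at h'
    obtain ⟨i, hi⟩ := h'
    lift i to I using (hi.1.trans_le le_top).ne
    exact Or.inr (Or.inl ⟨i, hi⟩)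

theorem nonempty_Iio_of_isSuccLimit {j : WithTop I} (hj : Order.IsSuccLimit j) :
    Nonempty (Set.Iio j) := by
  obtain ⟨k, hk⟩ := not_isMin_iff.1 hj.1
  exact ⟨⟨k, hk⟩⟩

theorem eventually_of_isSuccLimit {S : WithTop I → Y} {j : WithTop I}
    (hj : Order.IsSuccLimit j)
    (h : Tendsto (fun i : Set.Iio j => S i) atTop (𝓝 (S j))) {U : Set Y} (hU : U ∈ 𝓝 (S j)) :
    ∃ k < j, ∀ i, k ≤ i → i < j → S i ∈ U := by
  have := nonempty_Iio_of_isSuccLimit hj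
  obtain ⟨k, hk⟩ := eventually_atTop.1 (h.eventually hU)
  exact ⟨k, k.2, fun i hki hij => hk ⟨i, hij⟩ hki⟩

variable [WellFoundedLT I]

namespace IsTransfinitePartialSums

theorem unique {v : I → Y} {S S' : WithTop I → Y} (h : IsTransfinitePartialSums v S)
    (h' : IsTransfinitePartialSums v S') : S = S' := by
  funext j
  induction j using WellFoundedLT.induction with
  | ind j ih =>
    rcases isMin_or_covBy_or_isSuccLimit j with hj | ⟨i, hi⟩ | hj
    · rw [h.zero j hj, h'.zero j hj]
    · rw [h.succ i j hi, h'.succ i j hi, ih _ hi.1]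
    · have := nonempty_Iio_of_isSuccLimit hj
      refine tendsto_nhds_unique (h.limit j hj) ?_
      refine (h'.limit j hj).congr fun i => (ih i i.2).symm

theorem add {v w : I → Y} {S R : WithTop I → Y} (h : IsTransfinitePartialSums v S)
    (h' : IsTransfinitePartialSums w R) : IsTransfinitePartialSums (v + w) (S + R) where
  zero i hi := by simp [h.zero i hi, h'.zero i hi]
  succ i j hij := by
    simp only [Pi.add_apply, h.succ i j hij, h'.succ i j hij]; abel
  limit j hj := (h.limit j hj).add (h'.limit j hj)

theorem smul {𝕂 : Type*} [RCLike 𝕂] [Module 𝕂 Y] [ContinuousSMul 𝕂 Y] (c : 𝕂) {v : I → Y}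
    {S : WithTop I → Y} (h : IsTransfinitePartialSums v S) :
    IsTransfinitePartialSums (c • v) (c • S) where
  zero i hi := by simp [h.zero i hi]
  succ i j hij := by
    simp only [Pi.smul_apply, h.succ i j hij, smul_add]
  limit j hj := (h.limit j hj).const_smul c

theorem eq_of_forall_eq_zero {v : I → Y} {S : WithTop I → Y} (h : IsTransfinitePartialSums v S)
    {k j : WithTop I} (hkj : k ≤ j) (hv : ∀ i : I, k ≤ i → (i : WithTop I) < j → v i = 0) :
    S j = S k := by
  induction j using WellFoundedLT.induction with
  | ind j ih =>
    rcases hkj.eq_or_lt with rfl | hlt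
    · rfl
    rcases isMin_or_covBy_or_isSuccLimit j with hj | ⟨i, hi⟩ | hj
    · exact absurd hlt hj.not_lt
    · have hki : k ≤ i := hi.le_of_lt hlt
      rw [h.succ i j hi, hv i hki hi.1, add_zero,
        ih i hi.1 hki fun l hl hl' => hv l hl (hl'.trans hi.1)]
    · have := nonempty_Iio_of_isSuccLimit hj
      refine tendsto_nhds_unique (h.limit j hj) ?_
      refine tendsto_const_nhds.congr' ?_
      filter_upwards [eventually_ge_atTop (⟨k, hlt⟩ : Set.Iio j)] with i hi
      exact (ih i i.2 hi fun l hl hl' => hv l hl (hl'.trans i.2)).symm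

/-- Terms that vanish can be left out of a transfinite sum. -/
theorem restrict {v : I → Y} {S : WithTop I → Y} (h : IsTransfinitePartialSums v S)
    (J : Set I) (hJ : ∀ i ∉ J, v i = 0) :
    IsTransfinitePartialSums (fun j : J => v j)
      (fun j : WithTop J => S (j.map (fun i : J => (i : I)))) := by
  set m : WithTop J → WithTop I := WithTop.map (fun i : J => (i : I)) with hm
  have hmono : StrictMono m := (Subtype.strictMono_coe _).withTop_map
  have hmem : ∀ (j : WithTop J) (i : I), i ∈ J → (i : WithTop I) < m j →
      ∃ i' : J, (i' : WithTop J) < j ∧ (i' : I) = i := by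
    intro j i hi hlt
    exact ⟨⟨i, hi⟩, hmono.lt_iff_lt.1 hlt, rfl⟩
  refine ⟨fun j hj => ?_, fun i j hij => ?_, fun j hj => ?_⟩
  · obtain ⟨b, hb⟩ : ∃ b : WithTop I, IsMin b := by
      obtain ⟨b, -, hb⟩ := (wellFounded_lt (α := WithTop I)).has_min Set.univ ⟨⊤, trivial⟩
      exact ⟨b, fun a _ => not_lt.1 (hb a trivial)⟩
    have hbj : b ≤ m j := not_lt.1 fun hlt => hb.not_lt hlt
    rw [h.eq_of_forall_eq_zero hbj, h.zero b hb]
    intro i _ hij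
    by_contra hv
    obtain ⟨i', hi', -⟩ := hmem j i (by_contra fun hc => hv (hJ i hc)) hij
    exact hj.not_lt hi'
  · have hlt : ((i : I) : WithTop I) < m j := hmono hij.1
    have hsucc : ∃ s : WithTop I, ((i : I) : WithTop I) ⋖ s := by
      obtain ⟨s, hs, hmin⟩ := (wellFounded_lt (α := WithTop I)).has_min
        {s | ((i : I) : WithTop I) < s} ⟨_, hlt⟩
      exact ⟨s, hs, fun c hc hcs => hmin c hc hcs⟩
    obtain ⟨s, hs⟩ := hsucc
    have hsj : s ≤ m j := hs.ge_of_gt hlt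
    rw [h.eq_of_forall_eq_zero hsj, h.succ _ s hs]
    · rfl
    intro l hl hlj
    by_contra hv
    obtain ⟨l', hl', rfl⟩ := hmem j l (by_contra fun hc => hv (hJ l hc)) hlj
    refine hij.2 (c := (l' : WithTop J)) ?_ hl'
    exact hmono.lt_iff_lt.1 (hs.1.trans_le hl)
  · have := nonempty_Iio_of_isSuccLimit hj
    -- The least strict upper bound `s` of the `m i` with `i < j` may lie below `m j`, but only
    -- vanishing terms lie between them. It is a limit, so convergence of `S` at `s` transfers.
    obtain ⟨s, hs, hmin⟩ := (wellFounded_lt (α := WithTop I)).has_min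
      {s | ∀ i : WithTop J, i < j → m i < s} ⟨m j, fun i hi => hmono hi⟩
    have hcof : ∀ k < s, ∃ i < j, k ≤ m i := by
      intro k hk
      by_contra! hcon
      exact hmin k hcon hk
    have hsj : s ≤ m j := not_lt.1 (hmin (m j) (fun i hi => hmono hi))
    have hSs : S (m j) = S s := by
      refine h.eq_of_forall_eq_zero hsj fun l hl hlj => ?_
      by_contra hv
      obtain ⟨l', hl', rfl⟩ := hmem j l (by_contra fun hc => hv (hJ l hc)) hlj
      exact absurd (hs l' hl') (not_lt.2 hl)
    have hslim : Order.IsSuccLimit s := by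
      obtain ⟨i₀, hi₀⟩ := not_isMin_iff.1 hj.1
      refine ⟨not_isMin_iff.2 ⟨m i₀, hs i₀ hi₀⟩, fun b hb => ?_⟩
      obtain ⟨i, hi, hbi⟩ := hcof b hb.1
      have hnc := hj.2 i
      simp only [CovBy, not_and, not_forall, not_not] at hnc
      obtain ⟨c, hic, hcj⟩ := hnc hi
      exact hb.2 (hbi.trans_lt (hmono hic)) (hs c hcj)
    change Tendsto _ _ (𝓝 (S (m j)))
    rw [hSs]
    intro U hU
    obtain ⟨k, hk, hkU⟩ := eventually_of_isSuccLimit hslim (h.limit s hslim) hU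
    obtain ⟨i, hi, hki⟩ := hcof k hk
    refine mem_atTop_sets.2 ⟨⟨i, hi⟩, fun l hl => ?_⟩
    exact hkU _ (hki.trans (hmono.monotone hl)) (hs l l.2)

/-- Partial sums form a bounded set in the sense of topological vector spaces. By transfinite
induction, a neighbourhood of `S j` absorbs a whole tail below a limit `j`, and the induction
hypothesis handles the rest. -/
theorem exists_inv_smul_le {𝕂 : Type*} [RCLike 𝕂] [Module 𝕂 Y] [ContinuousSMul 𝕂 Y] {v : I → Y}
    {S : WithTop I → Y} (h : IsTransfinitePartialSums v S) {ε : ℝ} (hε : 0 < ε) (j : WithTop I) :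
    ∃ N : ℕ, ∀ n ≥ N, ∀ k ≤ j, ‖((n : 𝕂) + 1)⁻¹ • S k‖ < ε := by
  have hlocal : ∀ y : Y, ∃ U ∈ 𝓝 y, ∃ N : ℕ, ∀ n ≥ N, ∀ x ∈ U, ‖((n : 𝕂) + 1)⁻¹ • x‖ < ε := by
    intro y
    have hcont : Tendsto (fun p : 𝕂 × Y => ‖p.1 • p.2‖) (𝓝 0 ×ˢ 𝓝 y) (𝓝 0) := by
      rw [← nhds_prod_eq]
      have : Continuous fun p : 𝕂 × Y => ‖p.1 • p.2‖ := by fun_prop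
      simpa using this.tendsto (0, y)
    obtain ⟨V, hV, U, hU, hVU⟩ := mem_prod_iff.1 (hcont (Iio_mem_nhds hε))
    have hinv : Tendsto (fun n : ℕ => ((n : 𝕂) + 1)⁻¹) atTop (𝓝 0) := by
      simpa [one_div] using tendsto_one_div_add_atTop_nhds_zero_nat (𝕜 := 𝕂)
    obtain ⟨N, hN⟩ := eventually_atTop.1 (hinv hV)
    exact ⟨U, hU, N, fun n hn x hx => hVU (Set.mk_mem_prod (hN n hn) hx)⟩
  induction j using WellFoundedLT.induction with
  | ind j ih =>
    obtain ⟨U, hU, N, hN⟩ := hlocal (S j)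
    have hcase : ∀ l < j, (∀ k, l < k → k < j → S k ∈ U) →
        ∃ N : ℕ, ∀ n ≥ N, ∀ k ≤ j, ‖((n : 𝕂) + 1)⁻¹ • S k‖ < ε := by
      intro l hl hlU
      obtain ⟨M, hM⟩ := ih l hl
      refine ⟨max N M, fun n hn k hk => ?_⟩
      rcases hk.eq_or_lt with rfl | hk
      · exact hN n ((le_max_left _ _).trans hn) _ (mem_of_mem_nhds hU)
      rcases le_or_gt k l with hkl | hkl
      · exact hM n ((le_max_right _ _).trans hn) k hkl
      · exact hN n ((le_max_left _ _).trans hn) _ (hlU k hkl hk)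
    rcases isMin_or_covBy_or_isSuccLimit j with hj | ⟨i, hi⟩ | hj
    · refine ⟨N, fun n hn k hk => ?_⟩
      rw [hj.eq_of_le hk]
      exact hN n hn _ (mem_of_mem_nhds hU)
    · exact hcase i hi.1 fun k h1 h2 => absurd h2 (hi.2 h1)
    · obtain ⟨k, hk, hkU⟩ := eventually_of_isSuccLimit hj (h.limit j hj) hU
      exact hcase k hk fun i h1 h2 => hkU i h1.le h2

/-- Countably many transfinite sums can be added up if they are uniformly dominated. -/
theorem tsum [CompleteSpace Y] {v : ℕ → I → Y} {S : ℕ → WithTop I → Y} {b : ℕ → ℝ}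
    (h : ∀ n, IsTransfinitePartialSums (v n) (S n)) (hb : Summable b)
    (hS : ∀ n j, ‖S n j‖ ≤ b n) (w : I → Y)
    (hw : ∀ (i : I) (j : WithTop I), (i : WithTop I) ⋖ j → w i = ∑' n, S n j - ∑' n, S n i) :
    IsTransfinitePartialSums w (fun j => ∑' n, S n j) where
  zero i hi := by simp [(h _).zero i hi]
  succ i j hij := by simp only [hw i j hij]; abel
  limit j hj := tendsto_tsum_of_dominated_convergence hb (fun n => (h n).limit j hj)
    (Eventually.of_forall fun i n => hS n i)

end IsTransfinitePartialSums

theorem exists_coe_covBy (i : I) : ∃ j : WithTop I, (i : WithTop I) ⋖ j := by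
  obtain ⟨s, hs, hmin⟩ := (wellFounded_lt (α := WithTop I)).has_min
    {s | (i : WithTop I) < s} ⟨⊤, WithTop.coe_lt_top i⟩
  exact ⟨s, hs, fun c hc hcs => hmin c hc hcs⟩

end PartialSums

/-! ### Continuity of the coefficient functionals -/

namespace IsTransfiniteBasis

variable {𝕂 : Type*} [RCLike 𝕂] {I : Type*} [LinearOrder I] [WellFoundedLT I]
  {Y : Type*} [NormedAddCommGroup Y] [Module 𝕂 Y]

theorem exists_partialSums {e : I → Y} (he : IsTransfiniteBasis 𝕂 e) (y : Y) :
    ∃ (a : I → 𝕂) (S : WithTop I → Y), {i | a i ≠ 0}.Countable ∧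
      IsTransfinitePartialSums (fun i => a i • e i) S ∧ S ⊤ = y := by
  obtain ⟨a, ⟨h1, -, S, hS, hy⟩, -⟩ := he y
  exact ⟨a, S, h1, hS, hy⟩

/-- The sum over the support comes for free from the full sum by `restrict`, so uniqueness only
needs the full expansions. -/
theorem coeff_unique {e : I → Y} (he : IsTransfiniteBasis 𝕂 e) {a b : I → 𝕂}
    {S R : WithTop I → Y} (ha : {i | a i ≠ 0}.Countable)
    (hS : IsTransfinitePartialSums (fun i => a i • e i) S) (hb : {i | b i ≠ 0}.Countable)
    (hR : IsTransfinitePartialSums (fun i => b i • e i) R) (htop : S ⊤ = R ⊤) : a = b := by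
  have aux : ∀ (c : I → 𝕂) (Q : WithTop I → Y),
      IsTransfinitePartialSums (fun i => c i • e i) Q →
      HasTransfiniteSum (fun j : {i | c i ≠ 0} => c j • e j) (Q ⊤) := by
    intro c Q hQ
    refine ⟨_, hQ.restrict {i | c i ≠ 0} fun i hi => ?_, rfl⟩
    have hi : c i = 0 := by simpa using hi
    simp [hi]
  refine (he (S ⊤)).unique ⟨ha, aux a S hS, S, hS, rfl⟩ ⟨hb, ?_, R, hR, htop.symm⟩
  rw [htop]
  exact aux b R hR

theorem ne_zero {e : I → Y} (he : IsTransfiniteBasis 𝕂 e) (i : I) : e i ≠ 0 := by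
  classical
  intro hi
  have h0 : IsTransfinitePartialSums (0 : I → Y) (0 : WithTop I → Y) :=
    ⟨fun _ _ => rfl, fun _ _ _ => by simp, fun _ _ => tendsto_const_nhds⟩
  have h1 : (fun l => (0 : I → 𝕂) l • e l) = (0 : I → Y) := by funext l; simp
  have h2 : (fun l => (Pi.single i (1 : 𝕂) : I → 𝕂) l • e l) = (0 : I → Y) := by
    funext l
    rcases eq_or_ne l i with rfl | hl
    · simp [hi]
    · simp [hl]
  have := he.coeff_unique (a := 0) (b := Pi.single i 1) (by simp) (h1 ▸ h0)
    ((Set.countable_singleton i).mono fun l hl => by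
      by_contra hli
      exact hl (by simp [Set.mem_singleton_iff.not.1 hli])) (h2 ▸ h0) rfl
  simpa using congrFun this i

variable [ContinuousSMul 𝕂 Y] [CompleteSpace Y]

/-- Continuous additive real functionals separate the points of an F-space with a transfinite
basis. -/
theorem exists_continuous_ne_zero {e : I → Y} (he : IsTransfiniteBasis 𝕂 e) {y₀ : Y}
    (hy₀ : y₀ ≠ 0) : ∃ φ : Y →+ ℝ, Continuous φ ∧ φ y₀ ≠ 0 := by
  choose a S ha hS htop using he.exists_partialSums
  have hadd : ∀ x y, a (x + y) = a x + a y ∧ S (x + y) = S x + S y := by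
    intro x y
    have h1 : IsTransfinitePartialSums (fun i => (a x + a y) i • e i) (S x + S y) := by
      have := (hS x).add (hS y)
      convert this using 1
      funext i; simp [add_smul]
    have h2 : a (x + y) = a x + a y := by
      refine he.coeff_unique (ha _) (hS _) (((ha x).union (ha y)).mono fun i hi => ?_) h1 ?_
      · by_contra hc
        simp only [Set.mem_union, Set.mem_ofPred_eq, not_or, not_not] at hc
        exact hi (by simp [hc.1, hc.2])
      · simp [htop]
    exact ⟨h2, (hS (x + y)).unique (h2 ▸ h1)⟩
  have hsmul : ∀ (c : 𝕂) y, a (c • y) = c • a y ∧ S (c • y) = c • S y := by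
    intro c y
    have h1 : IsTransfinitePartialSums (fun i => (c • a y) i • e i) (c • S y) := by
      have := (hS y).smul c
      convert this using 1
      funext i; simp [smul_smul]
    have h2 : a (c • y) = c • a y := by
      refine he.coeff_unique (ha _) (hS _) ((ha y).mono fun i hi => ?_) h1 ?_
      · intro hc
        exact hi (by simp [hc])
      · simp [htop]
    exact ⟨h2, (hS (c • y)).unique (h2 ▸ h1)⟩
  have hsub : ∀ x y, S (x - y) = S x - S y := by
    intro x y
    rw [sub_eq_add_neg, (hadd _ _).2, ← neg_one_smul 𝕂 y, (hsmul _ _).2]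
    simp [sub_eq_add_neg]
  -- The functional in question is `y ↦ sup_j ‖S y j‖`: boundedness of partial sums makes it
  -- absorbing, and uniqueness of expansions makes it countably subadditive.
  have hball := exists_ball_subset_of_countably_subadditive 𝕂
    (fun ε => {y : Y | ∀ j, ‖S y j‖ ≤ ε}) (by
      intro c x hx y hy j
      rw [hsub, Pi.sub_apply]
      linarith [norm_sub_le (S x j) (S y j), hx j, hy j]) (by
      intro ε hε y
      obtain ⟨N, hN⟩ := (hS y).exists_inv_smul_le (𝕂 := 𝕂) hε ⊤
      refine ⟨N, fun j => ?_⟩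
      rw [(hsmul _ _).2]
      exact (hN N le_rfl j le_top).le) (by
      intro ε hε u y hu hy
      have hb : HasSum (fun n : ℕ => ε / 2 ^ (n + 1)) ε := by
        have := hasSum_geometric_two' ε
        convert this using 2 with n
        rw [pow_succ]; field_simp
      have hsummable : ∀ j, Summable fun n => S (u n) j := fun j =>
        Summable.of_norm_bounded hb.summable fun n => hu n j
      -- The line through `e i` is closed, so the jumps of the summed partial sums are still
      -- multiples of `e i` and define coefficients.
      have hspan : ∀ (i : I) (j : WithTop I), (i : WithTop I) ⋖ j →
          ∑' n, S (u n) j - ∑' n, S (u n) i ∈ Submodule.span 𝕂 {e i} := by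
        intro i j hij
        have hcl : IsClosed (Submodule.span 𝕂 {e i} : Set Y) :=
          Submodule.closed_of_finiteDimensional _
        rw [← (hsummable j).tsum_sub (hsummable i)]
        refine hcl.mem_of_tendsto ((hsummable j).sub (hsummable i)).hasSum
          (Eventually.of_forall fun s => Submodule.sum_mem _ fun n _ => ?_)
        rw [(hS (u n)).succ i j hij, add_sub_cancel_left]
        exact Submodule.smul_mem _ _ (Submodule.mem_span_singleton_self _)
      have hcoef : ∀ i : I, ∃ c : 𝕂, ∀ j : WithTop I, (i : WithTop I) ⋖ j →
          c • e i = ∑' n, S (u n) j - ∑' n, S (u n) i := by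
        intro i
        obtain ⟨s, hs⟩ := exists_coe_covBy i
        obtain ⟨c, hc⟩ := Submodule.mem_span_singleton.1 (hspan i s hs)
        exact ⟨c, fun j hj => by rw [hj.unique_right hs, hc]⟩
      choose c hc using hcoef
      have hT := IsTransfinitePartialSums.tsum (fun n => hS (u n)) hb.summable hu
        (fun i => c i • e i) hc
      have hcount : {i | c i ≠ 0}.Countable := by
        refine (Set.countable_iUnion fun n => ha (u n)).mono fun i hi => ?_
        by_contra hcon
        simp only [Set.mem_iUnion, Set.mem_ofPred_eq, not_exists, not_not] at hcon
        obtain ⟨s, hs⟩ := exists_coe_covBy i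
        have := hc i s hs
        have heq : ∀ n, S (u n) s = S (u n) i := fun n => by
          rw [(hS (u n)).succ i s hs, hcon n, zero_smul, add_zero]
        simp only [heq, sub_self, smul_eq_zero, he.ne_zero i, or_false] at this
        exact hi this
      have hTtop : ∑' n, S (u n) ⊤ = y := by
        have h1 := (hsummable ⊤).hasSum.tendsto_sum_nat
        simp only [htop] at h1 ⊢
        exact tendsto_nhds_unique h1 hy
      have hac : a y = c := he.coeff_unique (ha y) (hS y) hcount hT (by rw [htop, hTtop])
      have hST : S y = fun j => ∑' n, S (u n) j := (hS y).unique (hac ▸ hT)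
      intro j
      rw [hST]
      exact tsum_of_norm_bounded hb fun n => hu n j)
  let A : I → Y →ₗ[𝕂] 𝕂 := fun i =>
    { toFun := fun y => a y i
      map_add' := fun x y => by simp [(hadd x y).1]
      map_smul' := fun c y => by simp [(hsmul c y).1] }
  have hAcont : ∀ i, Continuous (A i) := by
    intro i
    obtain ⟨s, hs⟩ := exists_coe_covBy i
    let L : Y →+ Y := AddMonoidHom.mk' (fun y => a y i • e i)
      fun x y => by simp [(hadd x y).1, add_smul]
    have hL : Continuous L := by
      refine continuous_of_continuousAt_zero L ?_
      rw [Metric.continuousAt_iff]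
      intro ε hε
      obtain ⟨δ, hδ, h⟩ := hball (ε / 3) (by positivity)
      refine ⟨δ, hδ, fun {y} hy => ?_⟩
      have hy' := h y (by simpa using hy)
      have : L y = S y s - S y i := by
        rw [(hS y).succ i s hs, add_sub_cancel_left]; rfl
      rw [map_zero, dist_zero_right, this]
      linarith [norm_sub_le (S y s) (S y i), hy' s, hy' i]
    -- A scalar linear functional with closed kernel is continuous; as `e i ≠ 0`, the kernel is that
    -- of the continuous map `L`.
    refine LinearMap.continuous_of_isClosed_ker (A i) ?_
    have : ((A i).ker : Set Y) = L ⁻¹' {0} := by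
      ext y
      simp [L, A, he.ne_zero i]
    rw [this]
    exact isClosed_singleton.preimage hL
  obtain ⟨i, hi⟩ : ∃ i, a y₀ i ≠ 0 := by
    by_contra! hcon
    refine hy₀ ?_
    obtain ⟨b, -, hb⟩ := (wellFounded_lt (α := WithTop I)).has_min Set.univ ⟨⊤, trivial⟩
    rw [← htop y₀, (hS y₀).eq_of_forall_eq_zero (k := b) le_top (fun i _ _ => by simp [hcon i]),
      (hS y₀).zero b fun c _ => not_lt.1 (hb c trivial)]
  -- Multiplying by the conjugate makes the value at `y₀` equal to `|a y₀ i| ^ 2`, hence real and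
  -- nonzero.
  refine ⟨AddMonoidHom.mk' (fun y => RCLike.re (starRingEnd 𝕂 (a y₀ i) * A i y))
    fun x y => by simp only [map_add, mul_add], ?_, ?_⟩
  · exact RCLike.continuous_re.comp (continuous_const.mul (hAcont i))
  · change RCLike.re (starRingEnd 𝕂 (a y₀ i) * a y₀ i) ≠ 0
    rw [RCLike.conj_mul]
    norm_cast
    simpa using hi

end IsTransfiniteBasis

/-! ### Signs and characteristic functions in a Köthe space -/

section Signs

variable {Ω : Type*} [MeasurableSpace Ω] {μ : Measure Ω} {𝕂 : Type*} [RCLike 𝕂]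
  {X : Type*} [NormedAddCommGroup X] [Module 𝕂 X] {ι : X →ₗ[𝕂] (Ω →ₘ[μ] 𝕂)}

/-- The elements of `X` which are signs vanishing outside of `A`. -/
def signsWithin (ι : X →ₗ[𝕂] (Ω →ₘ[μ] 𝕂)) (A : Set Ω) : Set X :=
  {x | IsSign (ι x) ∧ ∀ᵐ ω ∂μ, ω ∉ A → ι x ω = 0}

theorem coeFn_map_zero : ∀ᵐ ω ∂μ, ι (0 : X) ω = 0 := by
  rw [map_zero]
  exact AEEqFun.coeFn_zero

theorem zero_mem_signsWithin (A : Set Ω) : (0 : X) ∈ signsWithin ι A := by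
  constructor
  · filter_upwards [coeFn_map_zero (ι := ι)] with ω hω
    exact Or.inr (Or.inl hω)
  · filter_upwards [coeFn_map_zero (ι := ι)] with ω hω _
    exact hω

theorem coeFn_map_add (x y : X) : ∀ᵐ ω ∂μ, ι (x + y) ω = ι x ω + ι y ω := by
  rw [map_add]
  exact AEEqFun.coeFn_add _ _

theorem coeFn_map_sub (x y : X) : ∀ᵐ ω ∂μ, ι (x - y) ω = ι x ω - ι y ω := by
  rw [map_sub]
  exact AEEqFun.coeFn_sub _ _

theorem coeFn_map_neg (x : X) : ∀ᵐ ω ∂μ, ι (-x) ω = -ι x ω := by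
  rw [map_neg]
  exact AEEqFun.coeFn_neg _

theorem neg_mem_signsWithin {A : Set Ω} {x : X} (hx : x ∈ signsWithin ι A) :
    -x ∈ signsWithin ι A := by
  constructor
  · filter_upwards [coeFn_map_neg (ι := ι) x, hx.1] with ω h1 h2
    rw [h1]
    rcases h2 with h2 | h2 | h2 <;> simp [h2]
  · filter_upwards [coeFn_map_neg (ι := ι) x, hx.2] with ω h1 h2 hω
    rw [h1, h2 hω, neg_zero]

theorem add_mem_signsWithin {A B : Set Ω} (hAB : Disjoint A B) {x y : X}
    (hx : x ∈ signsWithin ι A) (hy : y ∈ signsWithin ι B) : x + y ∈ signsWithin ι (A ∪ B) := by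
  constructor
  · filter_upwards [coeFn_map_add (ι := ι) x y, hx.1, hx.2, hy.1, hy.2] with ω h h1 h2 h3 h4
    rw [h]
    by_cases hA : ω ∈ A
    · simpa [h4 (hAB.notMem_of_mem_left hA)] using h1
    · simpa [h2 hA] using h3
  · filter_upwards [coeFn_map_add (ι := ι) x y, hx.2, hy.2] with ω h h2 h4 hω
    rw [Set.mem_union, not_or] at hω
    rw [h, h2 hω.1, h4 hω.2, add_zero]

theorem IsSignOn.mem_signsWithin {A : Set Ω} {x : X} (hx : IsSignOn (ι x) A) :
    x ∈ signsWithin ι A := by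
  refine ⟨hx.1, ?_⟩
  filter_upwards [hx.2] with ω h hω
  by_contra hc
  exact hω (h.1 hc)

theorem IsSignOn.neg {A : Set Ω} {x : X} (hx : IsSignOn (ι x) A) : IsSignOn (ι (-x)) A := by
  refine ⟨(neg_mem_signsWithin hx.mem_signsWithin).1, ?_⟩
  filter_upwards [coeFn_map_neg (ι := ι) x, hx.2] with ω h1 h2
  rw [h1, neg_ne_zero, h2]

theorem IsSignOn.add {A B : Set Ω} (hAB : Disjoint A B) {x y : X} (hx : IsSignOn (ι x) A)
    (hy : IsSignOn (ι y) B) : IsSignOn (ι (x + y)) (A ∪ B) := by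
  refine ⟨(add_mem_signsWithin hAB hx.mem_signsWithin hy.mem_signsWithin).1, ?_⟩
  filter_upwards [coeFn_map_add (ι := ι) x y, hx.2, hx.mem_signsWithin.2, hy.2,
    hy.mem_signsWithin.2] with ω h h1 h2 h3 h4
  rw [h, Set.mem_union, ← h1, ← h3]
  by_cases hA : ω ∈ A
  · simp [h4 (hAB.notMem_of_mem_left hA)]
  · simp [h2 hA]

theorem integrable_of_isSign [IsFiniteMeasure μ] {f : Ω →ₘ[μ] 𝕂} (hf : IsSign f) :
    Integrable f μ := by
  refine Integrable.of_bound f.aestronglyMeasurable 1 ?_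
  filter_upwards [hf] with ω h
  rcases h with h | h | h <;> simp [h]

theorem integral_map_add [IsFiniteMeasure μ] {x y : X} (hx : IsSign (ι x)) (hy : IsSign (ι y)) :
    ∫ ω, ι (x + y) ω ∂μ = ∫ ω, ι x ω ∂μ + ∫ ω, ι y ω ∂μ := by
  rw [← integral_add (integrable_of_isSign hx) (integrable_of_isSign hy)]
  exact integral_congr_ae (coeFn_map_add x y)

theorem integral_map_neg (x : X) : ∫ ω, ι (-x) ω ∂μ = -∫ ω, ι x ω ∂μ := by
  rw [← integral_neg]
  exact integral_congr_ae (coeFn_map_neg x)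

namespace IsKothe

theorem exists_indicator (hX : IsKothe ι) {A : Set Ω} (hA : MeasurableSet A) :
    ∃ x : X, ∀ᵐ ω ∂μ, ι x ω = A.indicator 1 ω := by
  obtain ⟨u, hu⟩ := hX.one_mem
  have hm : AEStronglyMeasurable (A.indicator (1 : Ω → 𝕂)) μ :=
    (stronglyMeasurable_one.indicator hA).aestronglyMeasurable
  obtain ⟨x, hx, -⟩ := hX.solid (AEEqFun.mk _ hm) u (by
    rw [hu]
    filter_upwards [AEEqFun.coeFn_mk _ hm, AEEqFun.coeFn_one (μ := μ) (β := 𝕂)] with ω h1 h2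
    rw [h1, h2]
    by_cases h : ω ∈ A <;> simp [h])
  exact ⟨x, by rw [hx]; exact AEEqFun.coeFn_mk _ hm⟩

theorem ext (hX : IsKothe ι) {x y : X} (h : ∀ᵐ ω ∂μ, ι x ω = ι y ω) : x = y :=
  hX.injective (AEEqFun.ext h)

/-- The characteristic function of the measurable set `A`, as an element of `X`. -/
noncomputable def char (hX : IsKothe ι) (A : Set Ω) : X :=
  open Classical in if hA : MeasurableSet A then (hX.exists_indicator hA).choose else 0

theorem coeFn_char (hX : IsKothe ι) {A : Set Ω} (hA : MeasurableSet A) :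
    ∀ᵐ ω ∂μ, ι (hX.char A) ω = A.indicator 1 ω := by
  rw [char, dif_pos hA]
  exact (hX.exists_indicator hA).choose_spec

theorem char_mem_signsWithin (hX : IsKothe ι) {A : Set Ω} (hA : MeasurableSet A) :
    hX.char A ∈ signsWithin ι A := by
  constructor
  · filter_upwards [hX.coeFn_char hA] with ω h
    by_cases hω : ω ∈ A <;> simp [h, hω]
  · filter_upwards [hX.coeFn_char hA] with ω h hω
    simp [h, hω]

theorem char_union (hX : IsKothe ι) {A B : Set Ω} (hA : MeasurableSet A) (hB : MeasurableSet B)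
    (hAB : Disjoint A B) : hX.char (A ∪ B) = hX.char A + hX.char B := by
  refine hX.ext ?_
  filter_upwards [coeFn_map_add (ι := ι) (hX.char A) (hX.char B), hX.coeFn_char hA,
    hX.coeFn_char hB, hX.coeFn_char (hA.union hB)] with ω h h1 h2 h3
  rw [h, h1, h2, h3, Set.indicator_union_of_disjoint hAB]

theorem exists_eq_char_sub_char (hX : IsKothe ι) {A : Set Ω} (hA : MeasurableSet A) {x : X}
    (hx : x ∈ signsWithin ι A) : ∃ P Q : Set Ω, MeasurableSet P ∧ MeasurableSet Q ∧ P ⊆ A ∧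
      Q ⊆ A ∧ x = hX.char P - hX.char Q := by
  have hmeas : ∀ c : 𝕂, MeasurableSet {ω | ι x ω = c} := fun c =>
    (ι x).stronglyMeasurable.measurableSet_eq_fun stronglyMeasurable_const
  refine ⟨_, _, (hmeas 1).inter hA, (hmeas (-1)).inter hA, Set.inter_subset_right,
    Set.inter_subset_right, hX.ext ?_⟩
  filter_upwards [coeFn_map_sub (ι := ι) (hX.char ({ω | ι x ω = 1} ∩ A))
    (hX.char ({ω | ι x ω = -1} ∩ A)), hX.coeFn_char ((hmeas 1).inter hA),
    hX.coeFn_char ((hmeas (-1)).inter hA), hx.1, hx.2] with ω h h1 h2 h3 h4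
  rw [h, h1, h2]
  have hne : (1 : 𝕂) ≠ -1 := self_ne_neg.2 one_ne_zero
  by_cases hω : ω ∈ A
  · rcases h3 with h3 | h3 | h3 <;> simp [h3, hω, hne, hne.symm]
  · simp [h4 hω, hω]

theorem exists_eq_char_sub_char_sdiff (hX : IsKothe ι) {A : Set Ω} (hA : MeasurableSet A) {x : X}
    (hx : IsSignOn (ι x) A) :
    ∃ P : Set Ω, MeasurableSet P ∧ P ⊆ A ∧ x = hX.char P - hX.char (A \ P) := by
  have hP : MeasurableSet ({ω | ι x ω = 1} ∩ A) :=
    ((ι x).stronglyMeasurable.measurableSet_eq_fun stronglyMeasurable_const).inter hA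
  refine ⟨_, hP, Set.inter_subset_right, hX.ext ?_⟩
  filter_upwards [coeFn_map_sub (ι := ι) (hX.char ({ω | ι x ω = 1} ∩ A))
    (hX.char (A \ ({ω | ι x ω = 1} ∩ A))), hX.coeFn_char hP,
    hX.coeFn_char (hA.diff hP), hx.1, hx.2] with ω h h1 h2 h3 h4
  rw [h, h1, h2]
  have hne : (1 : 𝕂) ≠ -1 := self_ne_neg.2 one_ne_zero
  by_cases hω : ω ∈ A
  · rcases h3 with h3 | h3 | h3
    · simp [h3, hω, hne.symm]
    · exact absurd h3 (h4.2 hω)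
    · simp [h3, hω]
  · have : ι x ω = 0 := by
      by_contra hc
      exact hω (h4.1 hc)
    simp [this, hω]

end IsKothe

/-! ### Variation of functionals on signs -/

/-- The variation on `A` of the finitely additive measure induced by `g`. -/
noncomputable def signVariation (ι : X →ₗ[𝕂] (Ω →ₘ[μ] 𝕂)) (g : X →+ ℝ) (A : Set Ω) : ℝ :=
  sSup (g '' signsWithin ι A)

theorem bddAbove_image_signsWithin {g : X →+ ℝ} (hg : BddAbove (g '' {x | IsSign (ι x)}))
    (A : Set Ω) : BddAbove (g '' signsWithin ι A) :=
  hg.mono (Set.image_mono fun _ hx => hx.1)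

theorem abs_le_signVariation {g : X →+ ℝ} (hg : BddAbove (g '' {x | IsSign (ι x)})) {A : Set Ω}
    {x : X} (hx : x ∈ signsWithin ι A) : |g x| ≤ signVariation ι g A := by
  have hb := bddAbove_image_signsWithin hg A
  refine abs_le'.2 ⟨le_csSup hb ⟨x, hx, rfl⟩, ?_⟩
  rw [← map_neg]
  exact le_csSup hb ⟨-x, neg_mem_signsWithin hx, rfl⟩

theorem signVariation_nonneg {g : X →+ ℝ} (hg : BddAbove (g '' {x | IsSign (ι x)}))
    (A : Set Ω) : 0 ≤ signVariation ι g A :=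
  (abs_nonneg _).trans (abs_le_signVariation hg (zero_mem_signsWithin A))

/-- Signs supported in disjoint sets add up to a sign, so near-optimal choices on `A` and `B`
combine. -/
theorem signVariation_add_le {g : X →+ ℝ} (hg : BddAbove (g '' {x | IsSign (ι x)}))
    {A B : Set Ω} (hAB : Disjoint A B) :
    signVariation ι g A + signVariation ι g B ≤ signVariation ι g (A ∪ B) := by
  have hne : ∀ A : Set Ω, (g '' signsWithin ι A).Nonempty := fun A =>
    ⟨_, 0, zero_mem_signsWithin A, rfl⟩
  rw [← le_sub_iff_add_le]
  refine csSup_le (hne A) ?_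
  rintro _ ⟨x, hx, rfl⟩
  rw [le_sub_comm]
  refine csSup_le (hne B) ?_
  rintro _ ⟨y, hy, rfl⟩
  rw [le_sub_iff_add_le', ← map_add]
  exact le_csSup (bddAbove_image_signsWithin hg _) ⟨_, add_mem_signsWithin hAB hx hy, rfl⟩

theorem signVariation_le {g : X →+ ℝ} {A : Set Ω} {c : ℝ}
    (h : ∀ x ∈ signsWithin ι A, g x ≤ c) : signVariation ι g A ≤ c := by
  refine csSup_le ⟨_, 0, zero_mem_signsWithin A, rfl⟩ ?_
  rintro _ ⟨x, hx, rfl⟩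
  exact h x hx

/-- If finitely many additive functionals are bounded on signs and simultaneously small on suitable
signs on each set, then an additive property of measurable sets that holds for all sets of small
total variation holds for all measurable sets. -/
theorem IsKothe.induction_of_small_variation (hX : IsKothe ι) {κ : Type*} [Fintype κ]
    {g : κ → X →+ ℝ} (hg : ∀ k, BddAbove (g k '' {x | IsSign (ι x)}))
    (hnarrow : ∀ A, MeasurableSet A → 0 < μ A → ∀ η : ℝ, 0 < η →
      ∃ x : X, IsSignOn (ι x) A ∧ ∀ k, |g k x| < η)
    {P : Set Ω → Prop} {δ : ℝ} (hδ : 0 < δ)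
    (hsmall : ∀ A, MeasurableSet A → ∑ k, signVariation ι (g k) A < δ → P A)
    (hnull : ∀ A, MeasurableSet A → μ A = 0 → P A)
    (hunion : ∀ A B, MeasurableSet A → MeasurableSet B → Disjoint A B → P A → P B → P (A ∪ B))
    {A : Set Ω} (hA : MeasurableSet A) : P A := by
  set w : Set Ω → ℝ := fun A => ∑ k, signVariation ι (g k) A with hw
  have hw0 : ∀ A, 0 ≤ w A := fun A => Finset.sum_nonneg fun k _ => signVariation_nonneg (hg k) A
  have hwadd : ∀ {C B : Set Ω}, C ⊆ B → w C + w (B \ C) ≤ w B := by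
    intro C B hCB
    have h1 : w C + w (B \ C) ≤ w (C ∪ B \ C) := by
      rw [hw, ← Finset.sum_add_distrib]
      exact Finset.sum_le_sum fun k _ => signVariation_add_le (hg k) Set.disjoint_sdiff_right
    rwa [Set.union_sdiff_cancel hCB] at h1
  have hle : ∀ k A, signVariation ι (g k) A ≤ w A := fun k A =>
    Finset.single_le_sum (f := fun k => signVariation ι (g k) A)
      (fun k _ => signVariation_nonneg (hg k) A) (Finset.mem_univ k)
  by_contra hPA
  let bad : Set (Set Ω) := {A | MeasurableSet A ∧ ¬ P A}
  have hbdd : BddBelow (w '' bad) := ⟨0, by rintro _ ⟨B, -, rfl⟩; exact hw0 B⟩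
  -- A bad set cannot be cut into two good ones; this replaces an explicit finite partition.
  have hsplit : ∀ {C B : Set Ω}, B ∈ bad → MeasurableSet C → C ⊆ B → C ∈ bad ∨ B \ C ∈ bad := by
    intro C B hB hC hCB
    by_contra hcon
    simp only [not_or, bad, Set.mem_ofPred_eq, not_and, not_not] at hcon
    refine hB.2 ?_
    rw [← Set.union_sdiff_cancel hCB]
    exact hunion _ _ hC (hB.1.diff hC) Set.disjoint_sdiff_right (hcon.1 hC)
      (hcon.2 (hB.1.diff hC))
  set α := sInf (w '' bad) with hα
  set η : ℝ := δ / (6 * Fintype.card κ + 1) with hη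
  have hηpos : 0 < η := by positivity
  -- `B` is bad with nearly minimal variation, so the complement in `B` of any bad subset has
  -- variation below `η`. The aim is to show that `B` itself has variation below `δ`.
  obtain ⟨_, ⟨B, hB, rfl⟩, hBα⟩ := exists_lt_of_csInf_lt (s := w '' bad)
    ⟨_, A, ⟨hA, hPA⟩, rfl⟩ (lt_add_of_pos_right α hηpos)
  have hαle : ∀ C ∈ bad, α ≤ w C := fun C hC => csInf_le hbdd ⟨C, hC, rfl⟩
  have hcompl : ∀ C ⊆ B, B \ C ∈ bad → w C < η := by
    intro C hCB hC
    linarith [hwadd hCB, hαle _ hC]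
  have hchar : ∀ C ⊆ B, MeasurableSet C → ∀ k, |g k (hX.char C)| ≤ 3 * η := by
    intro C hCB hC k
    have hg_le : ∀ D, MeasurableSet D → |g k (hX.char D)| ≤ w D := fun D hD =>
      (abs_le_signVariation (hg k) (hX.char_mem_signsWithin hD)).trans (hle k D)
    rcases hsplit hB hC hCB with hCbad | hCbad
    · have hμ : 0 < μ C := pos_iff_ne_zero.2 fun h => hCbad.2 (hnull C hC h)
      -- No atoms: one of `D`, `C \ D` is bad, so the other has variation below `η`. Since `g k
      -- (char D)` and `g k (char (C \ D))` differ by less than `η`, their sum is at most `3 * η` in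
      -- absolute value.
      obtain ⟨x, hx, hgx⟩ := hnarrow C hC hμ η hηpos
      obtain ⟨D, hD, hDC, rfl⟩ := hX.exists_eq_char_sub_char_sdiff hC hx
      have hsum : g k (hX.char C) = g k (hX.char D) + g k (hX.char (C \ D)) := by
        conv_lhs => rw [← Set.union_sdiff_cancel hDC]
        rw [hX.char_union hD (hC.diff hD) Set.disjoint_sdiff_right, map_add]
      have hxk := hgx k
      rw [map_sub, abs_lt] at hxk
      have hwC := hwadd hCB
      have hwD := hwadd hDC
      have h0 := hw0 (B \ C)
      rw [hsum, abs_le]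
      rcases hsplit hCbad hD hDC with hbad | hbad
      · have h1 := hg_le _ (hC.diff hD)
        have h2 := hαle _ hbad
        have h3 := abs_le.1 h1
        constructor <;> linarith
      · have h1 := hg_le _ hD
        have h2 := hαle _ hbad
        have h3 := abs_le.1 h1
        constructor <;> linarith
    · linarith [hg_le C hC, hcompl C hCB hCbad]
  have hvar : ∀ k, signVariation ι (g k) B ≤ 6 * η := by
    intro k
    refine signVariation_le fun x hx => ?_
    obtain ⟨C, D, hC, hD, hCB, hDB, rfl⟩ := hX.exists_eq_char_sub_char hB.1 hx
    rw [map_sub]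
    linarith [abs_le.1 (hchar C hCB hC k), abs_le.1 (hchar D hDB hD k)]
  refine hB.2 (hsmall B hB.1 ?_)
  calc ∑ k, signVariation ι (g k) B ≤ ∑ _k : κ, 6 * η := Finset.sum_le_sum fun k _ => hvar k
    _ = 6 * Fintype.card κ * η := by
      rw [Finset.sum_const, Finset.card_univ, nsmul_eq_mul]; ring
    _ < (6 * Fintype.card κ + 1) * η := by linarith
    _ = δ := by rw [hη]; field_simp

/-- A narrow operator and a finite family of functionals that are bounded on signs and
simultaneously small on suitable signs on each set are simultaneously small on some mean zero
sign. -/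
theorem IsNarrow.exists_isSignOn_small [IsFiniteMeasure μ] (hX : IsKothe ι)
    {Y : Type*} [NormedAddCommGroup Y] [Module 𝕂 Y] {T : X →L[𝕂] Y} (hT : IsNarrow ι T)
    {κ : Type*} [Fintype κ]
    {g : κ → X →+ ℝ} (hg : ∀ k, BddAbove (g k '' {x | IsSign (ι x)}))
    (hnarrow : ∀ A, MeasurableSet A → 0 < μ A → ∀ η : ℝ, 0 < η →
      ∃ x : X, IsSignOn (ι x) A ∧ ∀ k, |g k x| < η)
    {A : Set Ω} (hA : MeasurableSet A) {c ε : ℝ} (hc : 0 < c) (hε : 0 < ε) :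
    ∃ x : X, IsSignOn (ι x) A ∧ ∫ ω, ι x ω ∂μ = 0 ∧ ‖T x‖ < ε ∧ ∑ k, g k x ^ 2 < c := by
  set w : Set Ω → ℝ := fun A => ∑ k, signVariation ι (g k) A with hw
  have hw0 : ∀ A, 0 ≤ w A := fun A => Finset.sum_nonneg fun k _ => signVariation_nonneg (hg k) A
  -- Chosen so that `δ * w A < c`.
  set δ : ℝ := c / (w A + 1) with hδ
  have hδpos : 0 < δ := div_pos hc (by linarith [hw0 A])
  have key : ∀ ε : ℝ, 0 < ε → ∃ x : X, IsSignOn (ι x) A ∧ ∫ ω, ι x ω ∂μ = 0 ∧ ‖T x‖ < ε ∧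
      ∑ k, g k x ^ 2 ≤ δ * w A := by
    have hnull : ∀ A, μ A = 0 → IsSignOn (ι (0 : X)) A ∧ ∫ ω, ι (0 : X) ω ∂μ = 0 := by
      intro A hA
      have h0 := coeFn_map_zero (ι := ι)
      refine ⟨⟨(zero_mem_signsWithin A).1, ?_⟩, ?_⟩
      · filter_upwards [h0, measure_eq_zero_iff_ae_notMem.1 hA] with ω h1 h2
        simp only [h1, h2, ne_eq, not_true_eq_false]
      · rw [integral_congr_ae h0, integral_zero]
    -- `ε` is quantified inside the property because each union halves it, whereas `δ` stays fixed.
    refine hX.induction_of_small_variation hg hnarrow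
      (P := fun A => ∀ ε : ℝ, 0 < ε → ∃ x : X, IsSignOn (ι x) A ∧ ∫ ω, ι x ω ∂μ = 0 ∧ ‖T x‖ < ε ∧
        ∑ k, g k x ^ 2 ≤ δ * w A) hδpos ?_ ?_ ?_ hA
    · intro A hA hsmall ε hε
      have : ∃ x : X, IsSignOn (ι x) A ∧ ∫ ω, ι x ω ∂μ = 0 ∧ ‖T x‖ < ε := by
        rcases eq_or_ne (μ A) 0 with h0 | h0
        · exact ⟨0, (hnull A h0).1, (hnull A h0).2, by simpa using hε⟩
        · exact hT A hA (pos_iff_ne_zero.2 h0) ε hε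
      obtain ⟨x, hx, hx0, hxT⟩ := this
      refine ⟨x, hx, hx0, hxT, ?_⟩
      calc ∑ k, g k x ^ 2 ≤ ∑ k, δ * signVariation ι (g k) A := by
            refine Finset.sum_le_sum fun k _ => ?_
            have h1 := abs_le_signVariation (hg k) hx.mem_signsWithin
            have h2 : signVariation ι (g k) A ≤ w A :=
              Finset.single_le_sum (f := fun k => signVariation ι (g k) A)
                (fun k _ => signVariation_nonneg (hg k) A) (Finset.mem_univ k)
            rw [← sq_abs, sq]
            exact mul_le_mul (h1.trans (h2.trans hsmall.le)) h1 (abs_nonneg _) hδpos.le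
        _ = δ * w A := by rw [hw, Finset.mul_sum]
    · intro A _ h0 ε hε
      refine ⟨0, (hnull A h0).1, (hnull A h0).2, by simpa using hε, ?_⟩
      simpa using mul_nonneg hδpos.le (hw0 A)
    · intro A B _ _ hAB hPA hPB ε hε
      obtain ⟨x, hx, hx0, hxT, hxg⟩ := hPA (ε / 2) (half_pos hε)
      obtain ⟨y, hy, hy0, hyT, hyg⟩ := hPB (ε / 2) (half_pos hε)
      have hwadd : δ * w A + δ * w B ≤ δ * w (A ∪ B) := by
        rw [← mul_add]
        refine mul_le_mul_of_nonneg_left ?_ hδpos.le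
        rw [hw, ← Finset.sum_add_distrib]
        exact Finset.sum_le_sum fun k _ => signVariation_add_le (hg k) hAB
      have aux : ∀ y : X, IsSignOn (ι y) B → ∫ ω, ι y ω ∂μ = 0 → ‖T y‖ < ε / 2 →
          ∑ k, g k y ^ 2 ≤ δ * w B → ∑ k, g k x * g k y ≤ 0 →
          ∃ x : X, IsSignOn (ι x) (A ∪ B) ∧ ∫ ω, ι x ω ∂μ = 0 ∧ ‖T x‖ < ε ∧
            ∑ k, g k x ^ 2 ≤ δ * w (A ∪ B) := by
        intro y hy hy0 hyT hyg hxy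
        refine ⟨x + y, hx.add hAB hy, ?_, ?_, ?_⟩
        · rw [integral_map_add hx.1 hy.1, hx0, hy0, add_zero]
        · rw [map_add]
          linarith [norm_add_le (T x) (T y)]
        · have : ∑ k, g k (x + y) ^ 2
              = ∑ k, g k x ^ 2 + 2 * ∑ k, g k x * g k y + ∑ k, g k y ^ 2 := by
            rw [Finset.mul_sum, ← Finset.sum_add_distrib, ← Finset.sum_add_distrib]
            exact Finset.sum_congr rfl fun k _ => by rw [map_add]; ring
          linarith
      -- Replacing `y` by `-y` keeps all its properties and flips the cross term.
      rcases le_total (∑ k, g k x * g k y) 0 with hxy | hxy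
      · exact aux y hy hy0 hyT hyg hxy
      · exact aux (-y) hy.neg (by rw [integral_map_neg, hy0, neg_zero]) (by simpa using hyT)
          (by simpa using hyg) (by simpa using hxy)
  obtain ⟨x, hx, hx0, hxT, hxg⟩ := key ε hε
  refine ⟨x, hx, hx0, hxT, hxg.trans_lt ?_⟩
  rw [hδ, div_mul_eq_mul_div, div_lt_iff₀ (by linarith [hw0 A])]
  linarith

end Signs

/-! ### Compactness and conclusion -/

/-- On a compact set, smallness is detected by finitely many functionals out of a family of
continuous functionals that separates points from zero. -/
theorem IsCompact.exists_sum_sq_lt {Y : Type*} [NormedAddCommGroup Y] {K : Set Y}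
    (hK : IsCompact K) (hsep : ∀ y : Y, y ≠ 0 → ∃ φ : Y →+ ℝ, Continuous φ ∧ φ y ≠ 0)
    {ε : ℝ} (hε : 0 < ε) :
    ∃ (κ : Finset Y) (φ : Y → Y →+ ℝ), (∀ k, Continuous (φ k)) ∧
      ∃ c > 0, ∀ y ∈ K, ∑ k : κ, φ k y ^ 2 < c → ‖y‖ < ε := by
  have hsep' : ∀ y : Y, ∃ φ : Y →+ ℝ, Continuous φ ∧ (y ≠ 0 → φ y ≠ 0) := by
    intro y
    rcases eq_or_ne y 0 with rfl | hy
    · exact ⟨0, continuous_const, fun h => absurd rfl h⟩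
    · obtain ⟨φ, h1, h2⟩ := hsep y hy
      exact ⟨φ, h1, fun _ => h2⟩
  choose φ hφ hφ0 using hsep'
  -- Away from the ball, finitely many of the `φ y` have no common zero, so their sum of squares has
  -- a positive minimum `c`.
  have hK' : IsCompact (K \ Metric.ball 0 ε) := hK.diff Metric.isOpen_ball
  obtain ⟨κ, -, hκ⟩ := hK'.elim_nhds_subcover (fun y => {z | φ y z ≠ 0}) (by
    intro y hy
    refine (isOpen_ne_fun (hφ y) continuous_const).mem_nhds (hφ0 y ?_)
    rintro rfl
    exact hy.2 (Metric.mem_ball_self hε))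
  refine ⟨κ, φ, hφ, ?_⟩
  have hcont : Continuous fun y => ∑ k : κ, φ k y ^ 2 :=
    continuous_finsetSum _ fun k _ => (hφ k).pow 2
  rcases (K \ Metric.ball 0 ε).eq_empty_or_nonempty with hempty | hne
  · refine ⟨1, one_pos, fun y hy _ => ?_⟩
    simpa using Set.sdiff_eq_empty.1 hempty hy
  · obtain ⟨z, hz, hmin⟩ := hK'.exists_isMinOn hne hcont.continuousOn
    refine ⟨∑ k : κ, φ k z ^ 2, ?_, fun y hy hlt => ?_⟩
    · obtain ⟨k, hk, hkz⟩ := Set.mem_iUnion₂.1 (hκ hz)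
      exact Finset.sum_pos' (fun k _ => sq_nonneg _)
        ⟨⟨k, hk⟩, Finset.mem_univ _, sq_pos_of_ne_zero hkz⟩
    · by_contra hcon
      exact absurd (hmin ⟨hy, by simpa using hcon⟩) (not_le.2 hlt)

theorem theorem3 {Ω : Type*} [MeasurableSpace Ω] (μ : Measure Ω) [IsFiniteMeasure μ]
    (hμ : Atomless μ) {𝕂 : Type*} [RCLike 𝕂]
    {X : Type*} [NormedAddCommGroup X] [Module 𝕂 X] [ContinuousSMul 𝕂 X] [CompleteSpace X]
    (ι : X →ₗ[𝕂] (Ω →ₘ[μ] 𝕂)) (hX : IsKothe ι)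
    {Y : Type*} [NormedAddCommGroup Y] [Module 𝕂 Y] [ContinuousSMul 𝕂 Y] [CompleteSpace Y]
    {I : Type*} [LinearOrder I] [WellFoundedLT I] (e : I → Y) (he : IsTransfiniteBasis 𝕂 e)
    (T₁ T₂ : X →L[𝕂] Y) (hT₁ : IsNarrow ι T₁) (hT₂ : IsNarrow ι T₂)
    (hK : IsCompact (closure (T₂ '' {x : X | IsSign (ι x)}))) :
    IsNarrow ι (T₁ + T₂) := by
  intro A hA _ ε hε
  obtain ⟨κ, φ, hφ, c, hc, hφc⟩ :=
    hK.exists_sum_sq_lt (fun y hy => he.exists_continuous_ne_zero hy) (half_pos hε)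
  have hmem : ∀ x : X, IsSign (ι x) → T₂ x ∈ closure (T₂ '' {x : X | IsSign (ι x)}) :=
    fun x hx => subset_closure ⟨x, hx, rfl⟩
  -- Compactness bounds these functionals on signs; narrowness of `T₂` and continuity of the `φ k`
  -- at zero make them simultaneously small on some sign on each set of positive measure.
  let g : κ → X →+ ℝ := fun k => (φ k).comp (T₂ : X →ₗ[𝕂] Y).toAddMonoidHom
  have hgapp : ∀ k x, g k x = φ k (T₂ x) := fun k x => rfl
  obtain ⟨x, hx, hx0, hxT, hxg⟩ := hT₁.exists_isSignOn_small hX (g := g) (fun k => by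
      refine (hK.bddAbove_image (hφ k).continuousOn).mono ?_
      rintro _ ⟨x, hx, rfl⟩
      exact ⟨T₂ x, hmem x hx, rfl⟩) (fun A hA hμA η hη => by
      have hev : ∀ᶠ y in 𝓝 (0 : Y), ∀ k : κ, |φ k y| < η := by
        refine eventually_all.2 fun k => ?_
        have : Tendsto (fun y => |φ k y|) (𝓝 0) (𝓝 0) := by
          simpa using (hφ k).abs.tendsto 0
        exact this.eventually (gt_mem_nhds hη)
      obtain ⟨r, hr, hball⟩ := Metric.eventually_nhds_iff.1 hev
      obtain ⟨x, hx, -, hxT⟩ := hT₂ A hA hμA r hr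
      exact ⟨x, hx, hball (by simpa using hxT)⟩) hA hc (half_pos hε)
  refine ⟨x, hx, hx0, ?_⟩
  have h2 := hφc _ (hmem x hx.1) hxg
  rw [add_apply]
  linarith [norm_add_le (T₁ x) (T₂ x)]
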